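/- Let $A$ be a principal ideal domain, $X$ a locally compact Hausdorff space, $f\colon X\to\mathbb{R}$ a continuous function, $S\subset X$ a closed subset, $V$ an open subset of $S$ (for the subspace topology) and $x\in V$. For a topological space $Y$ let $A_Y$ be the constant sheaf with fiber $A$. For a closed subset $Z\subset Y$ let $\Gamma_Z$ be the left exact functor from sheaves of $A$-modules on $Y$ to sheaves of $A$-modules on $Y$ given by $\Gamma_Z(\mathcal F)(U)=\operatorname{Ker}(\mathcal F(U)\to\mathcal F(U\setminus Z))$. For a continuous function $g\colon Y\to\mathbb R$, a point $y\in Y$ and a sheaf $\mathcal F$ of $A$-modules on $Y$, the local Morse data of $\mathcal F$ and $g$ at $y$ is the $\mathbb Z$-graded $A$-module $$\operatorname{LMD}^{i}(\mathcal F,g,y):=H^{i}\bigl(R\Gamma_{\{g\ge g(y)\}}\mathcal F\bigr)_{y}\qquad(i\in\mathbb Z).$$ Let $\iota\colon S\to X$ be the inclusion and $(A_X)_S:=\iota_!\,\iota^{-1}A_X$, where $\iota_!$ is the direct image with proper supports. Then for every $i\in\mathbb Z$ there are isomorphisms of $A$-modules $$\operatorname{LMD}^{i}((A_X)_S,f,x)\simeq\operatorname{LMD}^{i}(A_S,f|_S,x)\simeq\operatorname{LMD}^{i}(A_V,f|_V,x)\simeq\varinjlim_{U}\tilde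 H^{i-1}(S\cap\{f<f(x)\}\cap U;A),$$ where $U$ runs over the open neighbourhoods of $x$ in $S$ and the transition maps are the restriction maps. Here $\tilde H^{m}(W;A)$, $m\in\mathbb Z$, is the reduced sheaf cohomology of $W$ with coefficients in the constant sheaf $A_W$: it is $H^{m}(W;A)$ for $m\ge 1$, the cokernel (for $m=0$) and the kernel (for $m=-1$) of the natural map $A\to H^{0}(W;A)$, and $0$ for $m\le -2$; in particular $\tilde H^{-1}(\emptyset;A)=A$. -/

import Mathlib

open CategoryTheory TopologicalSpace Opposite

universe u

noncomputable section

namespace LocalMorse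

variable {A : Type u} [CommRing A]

/-! ### Subsheaves cut out by a local condition -/

/-- A family of submodules `P U ⊆ F(U)` that is stable under restriction. -/
structure SubFamily {X : TopCat.{u}} (F : TopCat.Sheaf (ModuleCat.{u} A) X) where
  /-- the sections over `U` satisfying the condition -/
  carrier : ∀ U : Opens X, Submodule A (F.presheaf.obj (op U))
  /-- stability under restriction -/
  res : ∀ {U V : Opens X} (i : V ⟶ U) (s : F.presheaf.obj (op U)),
    s ∈ carrier U → (F.presheaf.map i.op) s ∈ carrier V

variable {X : TopCat.{u}} {F : TopCat.Sheaf (ModuleCat.{u} A) X}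

/-- The presheaf `U ↦ P U`. -/
def SubFamily.presheaf (P : SubFamily F) : TopCat.Presheaf (ModuleCat.{u} A) X where
  obj U := ModuleCat.of A (P.carrier U.unop)
  map {U V} i := ModuleCat.ofHom
    ((F.presheaf.map i).hom.restrict (fun s hs => P.res i.unop s hs))
  map_id U := by
    ext s
    change (F.presheaf.map (𝟙 U)) s.1 = s.1
    simp
  map_comp {U V W} i j := by
    ext s
    change (F.presheaf.map (i ≫ j)) s.1 = (F.presheaf.map j) ((F.presheaf.map i) s.1)
    simp

theorem SubFamily.presheaf_map_coe (P : SubFamily F) {U V : (Opens X)ᵒᵖ} (i : U ⟶ V)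
    (s : P.carrier U.unop) :
    ((P.presheaf.map i) s : P.carrier V.unop).1 = (F.presheaf.map i) s.1 := rfl

/-- If the condition is local, then the sections satisfying it form a sheaf. -/
theorem SubFamily.isSheaf (P : SubFamily F)
    (hloc : ∀ {ι : Type u} (U : ι → Opens X) (s : F.presheaf.obj (op (iSup U))),
      (∀ i, (F.presheaf.map (Opens.leSupr U i).op) s ∈ P.carrier (U i)) →
        s ∈ P.carrier (iSup U)) :
    P.presheaf.IsSheaf := by
  rw [TopCat.Presheaf.isSheaf_iff_isSheafUniqueGluing]
  intro ι U sf hsf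
  obtain ⟨s, hs, hu⟩ := TopCat.Sheaf.existsUnique_gluing F U
    (fun i => (show P.carrier (U i) from sf i).1)
    (fun i j => congrArg (fun t : P.carrier (U i ⊓ U j) => t.1) (hsf i j))
  refine ⟨(⟨s, hloc U s (fun i => ?_)⟩ : P.carrier (iSup U)), fun i => ?_, fun t ht => ?_⟩
  · rw [hs i]
    exact (show P.carrier (U i) from sf i).2
  · exact Subtype.ext (hs i)
  · exact Subtype.ext (hu (show P.carrier (iSup U) from t).1
      (fun i => congrArg (fun t : P.carrier (U i) => t.1) (ht i)))

/-! ### Sections supported in a closed subset -/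

/-- `Γ_Z(U; F)`: the sections of `F` over `U` that vanish on `U \ Z`. -/
def supportedFamily (Z : Closeds X) (F : TopCat.Sheaf (ModuleCat.{u} A) X) : SubFamily F where
  carrier U := LinearMap.ker
    (F.presheaf.map (homOfLE (inf_le_left : U ⊓ Z.compl ≤ U)).op).hom
  res {U V} i s hs := by
    rw [LinearMap.mem_ker] at hs ⊢
    have h := congrArg (F.presheaf.map
      (homOfLE (inf_le_inf_right Z.compl i.le : V ⊓ Z.compl ≤ U ⊓ Z.compl)).op) hs
    rw [map_zero] at h
    rw [← h]
    change (F.presheaf.map _) ((F.presheaf.map _) s) = (F.presheaf.map _) ((F.presheaf.map _) s)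
    rw [← ConcreteCategory.comp_apply, ← ConcreteCategory.comp_apply, ← F.presheaf.map_comp,
      ← F.presheaf.map_comp]
    rfl

theorem mem_supportedFamily (Z : Closeds X) (F : TopCat.Sheaf (ModuleCat.{u} A) X)
    (U : Opens X) (s : F.presheaf.obj (op U)) :
    s ∈ (supportedFamily Z F).carrier U ↔
      (F.presheaf.map (homOfLE (inf_le_left : U ⊓ Z.compl ≤ U)).op) s = 0 := Iff.rfl

theorem supportedFamily_isSheaf (Z : Closeds X) (F : TopCat.Sheaf (ModuleCat.{u} A) X) :
    (supportedFamily Z F).presheaf.IsSheaf := by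
  refine SubFamily.isSheaf _ (fun {ι} U s hs => ?_)
  rw [mem_supportedFamily]
  refine TopCat.Sheaf.eq_of_locally_eq' F (fun i => U i ⊓ Z.compl) _
    (fun i => homOfLE (inf_le_inf_right _ (le_iSup U i))) ?_ _ _ (fun i => ?_)
  · rw [iSup_inf_eq]
  · have h := hs i
    rw [mem_supportedFamily] at h
    rw [map_zero, ← h, ← ConcreteCategory.comp_apply, ← ConcreteCategory.comp_apply,
      ← F.presheaf.map_comp, ← F.presheaf.map_comp]
    rfl

variable (A) in
/-- The functor `Γ_Z : Mod(A_X) ⥤ Mod(A_X)` of sections supported in the closed subset `Z`,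
`Γ_Z(F)(U) = ker (F(U) → F(U \ Z))`. -/
def sectionsWithSupport (Z : Closeds X) :
    TopCat.Sheaf (ModuleCat.{u} A) X ⥤ TopCat.Sheaf (ModuleCat.{u} A) X where
  obj F := ⟨(supportedFamily Z F).presheaf, supportedFamily_isSheaf Z F⟩
  map {F G} φ := ⟨
    { app := fun U => ModuleCat.ofHom ((φ.1.app U).hom.restrict (fun s hs => by
        have hs' := (mem_supportedFamily Z F U.unop s).1 hs
        refine (mem_supportedFamily Z G U.unop _).2 ?_
        have h := NatTrans.naturality_apply φ.1
          (homOfLE (inf_le_left : U.unop ⊓ Z.compl ≤ U.unop)).op s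
        exact h.symm.trans ((congrArg _ hs').trans (map_zero _))))
      naturality := fun U V i => by
        ext s
        exact Subtype.ext (NatTrans.naturality_apply φ.1 i
          (show (supportedFamily Z F).carrier U.unop from s).1) }⟩
  map_id F := by
    apply CategoryTheory.Sheaf.hom_ext
    rfl
  map_comp f g := by
    apply CategoryTheory.Sheaf.hom_ext
    rfl

instance (Z : Closeds X) : (sectionsWithSupport A Z).Additive where
  map_add := by
    intros
    apply CategoryTheory.Sheaf.hom_ext
    rfl

/-! ### Direct image with proper supports -/

/-- The support of a section: the points where its germ does not vanish. -/
def supp (F : TopCat.Sheaf (ModuleCat.{u} A) X) {U : Opens X} (s : F.presheaf.obj (op U)) :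
    Set X :=
  {x | ∃ hx : x ∈ U, (F.presheaf.germ U x hx) s ≠ 0}

theorem supp_subset (F : TopCat.Sheaf (ModuleCat.{u} A) X) {U : Opens X}
    (s : F.presheaf.obj (op U)) : supp F s ⊆ U := fun _ h => h.1

theorem supp_add_subset (F : TopCat.Sheaf (ModuleCat.{u} A) X) {U : Opens X}
    (s t : F.presheaf.obj (op U)) : supp F (s + t) ⊆ supp F s ∪ supp F t := by
  rintro y ⟨hy, h⟩
  by_contra hn
  rw [Set.mem_union, not_or] at hn
  have h1 := not_not.1 (fun h => hn.1 ⟨hy, h⟩)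
  have h2 := not_not.1 (fun h => hn.2 ⟨hy, h⟩)
  exact h (by rw [map_add, h1, h2, add_zero])

theorem supp_smul_subset (F : TopCat.Sheaf (ModuleCat.{u} A) X) {U : Opens X} (a : A)
    (s : F.presheaf.obj (op U)) : supp F (a • s) ⊆ supp F s := by
  rintro y ⟨hy, h⟩
  refine ⟨hy, fun h0 => h ?_⟩
  have := (F.presheaf.germ U y hy).hom.map_smul a s
  exact this.trans ((congrArg (a • ·) h0).trans (smul_zero a))

variable {Y : TopCat.{u}}

/-- For a section `s` of `G` over `f⁻¹(U)`, the map `f : supp s → U` is proper. -/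
def HasProperSupport (f : Y ⟶ X) (G : TopCat.Sheaf (ModuleCat.{u} A) Y) (U : Opens X)
    (s : G.presheaf.obj (op ((Opens.map f).obj U))) : Prop :=
  IsProperMap (fun y : supp G s => (⟨f y.1, supp_subset G s y.2⟩ : U))

theorem hasProperSupport_iff [T2Space X] [LocallyCompactSpace X] (f : Y ⟶ X)
    (G : TopCat.Sheaf (ModuleCat.{u} A) Y) (U : Opens X)
    (s : G.presheaf.obj (op ((Opens.map f).obj U))) :
    HasProperSupport f G U s ↔
      ∀ K : Set X, K ⊆ U → IsCompact K → IsCompact (supp G s ∩ f ⁻¹' K) := by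
  have : LocallyCompactSpace U := U.2.locallyCompactSpace
  have key : ∀ K : Set U, (Subtype.val : supp G s → Y) ''
      ((fun y : supp G s => (⟨f y.1, supp_subset G s y.2⟩ : U)) ⁻¹' K) =
        supp G s ∩ f ⁻¹' (Subtype.val '' K) := by
    intro K
    ext y
    constructor
    · rintro ⟨y, hy, rfl⟩
      exact ⟨y.2, _, hy, rfl⟩
    · rintro ⟨hy, u, hu, huy⟩
      refine ⟨⟨y, hy⟩, ?_, rfl⟩
      rw [Set.mem_preimage]
      convert hu
      exact Subtype.ext huy.symm
  rw [HasProperSupport, isProperMap_iff_isCompact_preimage]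
  constructor
  · rintro ⟨-, h⟩ K hKU hK
    have hK' : (Subtype.val : U → X) '' (Subtype.val ⁻¹' K) = K := by
      exact (Subtype.image_preimage_coe _ _).trans (Set.inter_eq_right.2 hKU)
    have h2 := (h (K := (Subtype.val : U → X) ⁻¹' K)
      (by rwa [Subtype.isCompact_iff, hK'])).image continuous_subtype_val
    rwa [key, hK'] at h2
  · intro h
    refine ⟨by fun_prop, fun K hK => ?_⟩
    rw [Subtype.isCompact_iff, key]
    refine h _ ?_ (Subtype.isCompact_iff.1 hK)
    rintro _ ⟨u, -, rfl⟩
    exact u.2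

theorem isClosed_supp_inter (F : TopCat.Sheaf (ModuleCat.{u} A) X) {U : Opens X}
    (s : F.presheaf.obj (op U)) : ∃ C : Set X, IsClosed C ∧ supp F s = C ∩ U := by
  refine ⟨closure (supp F s), isClosed_closure, Set.Subset.antisymm
    (fun x hx => ⟨subset_closure hx, hx.1⟩) ?_⟩
  rintro x ⟨hx, hxU⟩
  refine ⟨hxU, fun h0 => ?_⟩
  obtain ⟨W, hxW, iU, iV, h⟩ := TopCat.Presheaf.germ_eq F.presheaf x hxU hxU s 0
    (by rw [h0, map_zero])
  obtain ⟨y, hyW, hyU, hy⟩ := mem_closure_iff.1 hx W W.2 hxW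
  apply hy
  rw [← TopCat.Presheaf.germ_res_apply F.presheaf iU y hyW s, h, map_zero, map_zero]

/-- The sections of `f_* G` with proper support. -/
def properFamily [T2Space X] [LocallyCompactSpace X] (f : Y ⟶ X)
    (G : TopCat.Sheaf (ModuleCat.{u} A) Y) :
    SubFamily ((TopCat.Sheaf.pushforward (ModuleCat.{u} A) f).obj G) where
  carrier U :=
    { carrier := {s | HasProperSupport f G U s}
      zero_mem' := by
        refine (hasProperSupport_iff f G U _).2 (fun K _ _ => ?_)
        convert isCompact_empty
        rw [Set.eq_empty_iff_forall_notMem]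
        rintro y ⟨⟨hy, h⟩, -⟩
        exact h (map_zero _)
      add_mem' := by
        intro s t hs ht
        refine (hasProperSupport_iff f G U _).2 (fun K hKU hK => ?_)
        have hc := ((hasProperSupport_iff f G U s).1 hs K hKU hK).union
          ((hasProperSupport_iff f G U t).1 ht K hKU hK)
        obtain ⟨C, hC, hCU⟩ := isClosed_supp_inter G (U := (Opens.map f).obj U) (s + t)
        have hsub := supp_add_subset G (U := (Opens.map f).obj U) s t
        convert hc.inter_right hC using 1
        ext y
        constructor
        · rintro ⟨hy, hyK⟩
          refine ⟨?_, (hCU.subset hy).1⟩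
          exact (hsub hy).imp (fun h => ⟨h, hyK⟩) (fun h => ⟨h, hyK⟩)
        · rintro ⟨h | h, hyC⟩
          · exact ⟨hCU.superset ⟨hyC, h.1.1⟩, h.2⟩
          · exact ⟨hCU.superset ⟨hyC, h.1.1⟩, h.2⟩
      smul_mem' := by
        intro a s hs
        refine (hasProperSupport_iff f G U _).2 (fun K hKU hK => ?_)
        have hc := (hasProperSupport_iff f G U s).1 hs K hKU hK
        obtain ⟨C, hC, hCU⟩ := isClosed_supp_inter G (U := (Opens.map f).obj U) (a • s)
        convert hc.inter_right hC using 1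
        ext y
        constructor
        · rintro ⟨hy, hyK⟩
          exact ⟨⟨supp_smul_subset G (U := (Opens.map f).obj U) a s hy, hyK⟩, (hCU.subset hy).1⟩
        · rintro ⟨h, hyC⟩
          exact ⟨hCU.superset ⟨hyC, h.1.1⟩, h.2⟩ }
  res {U V} i s hs := by
    refine (hasProperSupport_iff f G V _).2 (fun K hKV hK => ?_)
    have hc := (hasProperSupport_iff f G U s).1 hs K (hKV.trans i.le) hK
    convert hc using 1
    ext y
    refine and_congr_left (fun hyK => ?_)
    have hyV : y ∈ (Opens.map f).obj V := hKV hyK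
    have hg := TopCat.Presheaf.germ_res_apply G.presheaf ((Opens.map f).map i) y hyV s
    constructor
    · rintro ⟨_, h⟩
      exact ⟨(Opens.map f).map i |>.le hyV, fun h0 => h (hg.trans h0)⟩
    · rintro ⟨_, h⟩
      exact ⟨hyV, fun h0 => h (hg.symm.trans h0)⟩

theorem properFamily_isSheaf [T2Space X] [LocallyCompactSpace X] (f : Y ⟶ X)
    (G : TopCat.Sheaf (ModuleCat.{u} A) Y) : (properFamily f G).presheaf.IsSheaf := by
  refine SubFamily.isSheaf _ (fun {ι} U s hs => ?_)
  refine (hasProperSupport_iff f G (iSup U) s).2 (fun K hKU hK => ?_)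
  have hcov : K ⊆ ⋃ i, (U i : Set X) := by rwa [← Opens.coe_iSup]
  obtain ⟨t, ht⟩ := hK.elim_finite_subcover _ (fun i => (U i).2) hcov
  obtain ⟨L, hL, hLU, rfl⟩ := hK.finite_compact_cover t (fun i => (U i : Set X))
    (fun i _ => (U i).2) ht
  have : supp G s ∩ f ⁻¹' (⋃ i ∈ t, L i) = ⋃ i ∈ t, (supp G s ∩ f ⁻¹' (L i)) := by
    ext y
    simp only [Set.mem_inter_iff, Set.mem_preimage, Set.mem_iUnion]
    tauto
  rw [this]
  refine t.isCompact_biUnion (fun i _ => ?_)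
  convert (hasProperSupport_iff f G (U i) _).1 (hs i) (L i) (hLU i) (hL i) using 1
  ext y
  refine and_congr_left (fun hyK => ?_)
  have hyV : y ∈ (Opens.map f).obj (U i) := hLU i hyK
  have hg := TopCat.Presheaf.germ_res_apply G.presheaf
    ((Opens.map f).map (Opens.leSupr U i)) y hyV s
  constructor
  · rintro ⟨_, h⟩
    exact ⟨hyV, fun h0 => h (hg.symm.trans h0)⟩
  · rintro ⟨_, h⟩
    exact ⟨(Opens.map f).map (Opens.leSupr U i) |>.le hyV, fun h0 => h (hg.trans h0)⟩

/-- The direct image with proper supports `f_! G`: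
`(f_! G)(U) = {s ∈ G(f⁻¹(U)) | f : supp s → U is proper}`. -/
def properPushforward [T2Space X] [LocallyCompactSpace X] (f : Y ⟶ X)
    (G : TopCat.Sheaf (ModuleCat.{u} A) Y) : TopCat.Sheaf (ModuleCat.{u} A) X :=
  ⟨(properFamily f G).presheaf, properFamily_isSheaf f G⟩

/-! ### Constant sheaves and the sheaf `F_Z` -/

variable (A) in
/-- The constant sheaf `A_X`: the sheafification of the constant presheaf with value `A`. -/
def constSheaf (X : TopCat.{u}) : TopCat.Sheaf (ModuleCat.{u} A) X :=
  (constantSheaf (Opens.grothendieckTopology X) (ModuleCat.{u} A)).obj (ModuleCat.of A A)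

/-- The inclusion of a subspace, as a morphism of `TopCat`. -/
def incl {X : Type u} [TopologicalSpace X] (Z : Set X) : TopCat.of Z ⟶ TopCat.of X :=
  TopCat.ofHom ⟨Subtype.val, continuous_subtype_val⟩

/-- `F_Z = i_! i⁻¹ F`, where `i : Z → X` is the inclusion of a subspace. -/
def cutOff {X : Type u} [TopologicalSpace X] [T2Space X] [LocallyCompactSpace X]
    (F : TopCat.Sheaf (ModuleCat.{u} A) (TopCat.of X)) (Z : Set X) :
    TopCat.Sheaf (ModuleCat.{u} A) (TopCat.of X) :=
  haveI : T2Space (TopCat.of X) := ‹T2Space X›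
  haveI : LocallyCompactSpace (TopCat.of X) := ‹LocallyCompactSpace X›
  properPushforward (incl Z) ((TopCat.Sheaf.pullback (ModuleCat.{u} A) (incl Z)).obj F)

/-! ### Local Morse data -/

/-- The closed subset `{f ≥ f(x)}`. -/
def superlevel {X : Type u} [TopologicalSpace X] (f : C(X, ℝ)) (x : X) :
    Closeds (TopCat.of X) :=
  ⟨{y : X | f x ≤ f y}, isClosed_le continuous_const f.continuous⟩

/-- The local Morse data of a sheaf `F`, in degree `i ∈ ℤ`: the stalk at `x` of
`H^i(RΓ_{f ≥ f(x)} F)`, which is the right derived functor `R^i Γ_{f ≥ f(x)}` at `F` for `i ≥ 0`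
and zero for `i < 0`. -/
def LMD {X : Type u} [TopologicalSpace X] (F : TopCat.Sheaf (ModuleCat.{u} A) (TopCat.of X))
    (f : C(X, ℝ)) (x : X) : ℤ → ModuleCat.{u} A
  | Int.ofNat n =>
      (((sectionsWithSupport A (superlevel f x)).rightDerived n).obj F).presheaf.stalk
        (X := TopCat.of X) x
  | Int.negSucc _ => ModuleCat.of A PUnit

/-! ### Reduced cohomology of open subsets -/

variable (A) in
/-- The sections functor `Γ(W; -)` for an open subset `W` of `X`. -/
def sections (W : (Opens X)ᵒᵖ) : TopCat.Sheaf (ModuleCat.{u} A) X ⥤ ModuleCat.{u} A where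
  obj F := F.presheaf.obj W
  map φ := φ.1.app W
  map_id _ := rfl
  map_comp _ _ := rfl

instance (W : (Opens X)ᵒᵖ) : (sections A W).Additive where
  map_add := rfl

variable (A) in
/-- The restriction `Γ(W; -) ⟶ Γ(W'; -)` for `W' ⊆ W`. -/
def sectionsRes {W W' : (Opens X)ᵒᵖ} (i : W ⟶ W') : sections A W ⟶ sections A W' where
  app F := F.presheaf.map i
  naturality _ _ φ := (φ.1.naturality i).symm

/-- The presheaf `W ↦ H^n(W; F) = R^n Γ(W; -) (F)` on `X`. -/
def cohomology (F : TopCat.Sheaf (ModuleCat.{u} A) X) (n : ℕ) :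
    (Opens X)ᵒᵖ ⥤ ModuleCat.{u} A where
  obj W := ((sections A W).rightDerived n).obj F
  map i := (NatTrans.rightDerived (sectionsRes A i) n).app F
  map_id W := by
    have : sectionsRes A (𝟙 W) = 𝟙 _ := by
      ext F : 2
      exact F.presheaf.map_id W
    rw [this, NatTrans.rightDerived_id]
    rfl
  map_comp i j := by
    have : sectionsRes A (i ≫ j) = sectionsRes A i ≫ sectionsRes A j := by
      ext F : 2
      exact F.presheaf.map_comp i j
    rw [this, NatTrans.rightDerived_comp]
    rfl

theorem toRightDerivedZero_naturality {C D : Type*} [Category* C] [Category* D] [Abelian C]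
    [Abelian D] [HasInjectiveResolutions C] {G H : C ⥤ D} [G.Additive] [H.Additive]
    (α : G ⟶ H) (M : C) :
    α.app M ≫ H.toRightDerivedZero.app M =
      G.toRightDerivedZero.app M ≫ (NatTrans.rightDerived α 0).app M := by
  have I := injectiveResolution M
  have h : α.app M ≫ I.toRightDerivedZero' H = I.toRightDerivedZero' G ≫
      HomologicalComplex.cyclesMap
        ((NatTrans.mapHomologicalComplex α (ComplexShape.up ℕ)).app I.cocomplex) 0 := by
    rw [← cancel_mono (HomologicalComplex.iCycles _ _), Category.assoc, Category.assoc,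
      InjectiveResolution.toRightDerivedZero'_comp_iCycles, HomologicalComplex.cyclesMap_i,
      InjectiveResolution.toRightDerivedZero'_comp_iCycles_assoc]
    exact (α.naturality (I.ι.f 0)).symm
  rw [I.toRightDerivedZero_eq, I.toRightDerivedZero_eq, I.rightDerived_app_eq]
  let KG := (G.mapHomologicalComplex (ComplexShape.up ℕ)).obj I.cocomplex
  let KH := (H.mapHomologicalComplex (ComplexShape.up ℕ)).obj I.cocomplex
  let a : KG ⟶ KH := (NatTrans.mapHomologicalComplex α (ComplexShape.up ℕ)).app I.cocomplex
  let eG : (G.rightDerived 0).obj M ≅ KG.homology 0 := I.isoRightDerivedObj G 0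
  let eH : (H.rightDerived 0).obj M ≅ KH.homology 0 := I.isoRightDerivedObj H 0
  change α.app M ≫ I.toRightDerivedZero' H ≫ KH.homologyπ 0 ≫ eH.inv =
    (I.toRightDerivedZero' G ≫ KG.homologyπ 0 ≫ eG.inv) ≫
      eG.hom ≫ HomologicalComplex.homologyMap a 0 ≫ eH.inv
  have h' : α.app M ≫ I.toRightDerivedZero' H =
      I.toRightDerivedZero' G ≫ HomologicalComplex.cyclesMap a 0 := h
  rw [reassoc_of% h', Category.assoc, Category.assoc, Iso.inv_hom_id_assoc,
    HomologicalComplex.homologyπ_naturality_assoc]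

/-- The natural map `Γ(W; F) ⟶ H^0(W; F)`. -/
def toCohomologyZero (F : TopCat.Sheaf (ModuleCat.{u} A) X) :
    F.presheaf ⟶ cohomology F 0 where
  app W := (sections A W).toRightDerivedZero.app F
  naturality _ _ i := toRightDerivedZero_naturality (sectionsRes A i) F

variable (A X) in
/-- The natural map `A ⟶ Γ(W; A_X)` sending `a` to the constant section `a`. -/
def constSection :
    (Functor.const (Opens X)ᵒᵖ).obj (ModuleCat.of A A) ⟶ (constSheaf A X).presheaf :=
  toSheafify (Opens.grothendieckTopology X) ((Functor.const (Opens X)ᵒᵖ).obj (ModuleCat.of A A))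

variable (A X) in
/-- The augmentation `A ⟶ H^0(W; A)`, natural in the open subset `W ⊆ X`. -/
def augmentation :
    (Functor.const (Opens X)ᵒᵖ).obj (ModuleCat.of A A) ⟶ cohomology (constSheaf A X) 0 :=
  constSection A X ≫ toCohomologyZero (constSheaf A X)

variable (A X) in
/-- The presheaf `W ↦ H̃^m(W; A)`, `m ∈ ℤ`, of reduced cohomology on the open subsets of `X`,
with coefficients in the constant sheaf: the cohomology of the augmented complex, i.e.
`H^m(W; A)` for `m ≥ 1`, the cokernel and the kernel of the augmentation `A ⟶ H^0(W; A)` for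
`m = 0` and `m = -1`, and zero for `m ≤ -2`. -/
def reducedCohomology : ℤ → ((Opens X)ᵒᵖ ⥤ ModuleCat.{u} A)
  | Int.ofNat 0 => Limits.cokernel (augmentation A X)
  | Int.ofNat (n + 1) => cohomology (constSheaf A X) (n + 1)
  | Int.negSucc 0 => Limits.kernel (augmentation A X)
  | Int.negSucc (_ + 1) => (Functor.const _).obj (ModuleCat.of A PUnit)

/-- The direct limit of `H̃^m({f < f(x)} ∩ U; A)` over the open neighbourhoods `U` of `x`, where
`{f < f(x)} ∩ U` is regarded as an open subset of the space `{f < f(x)}`. -/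
def limReducedCohomology (A : Type u) [CommRing A] {X : Type u} [TopologicalSpace X]
    (f : C(X, ℝ)) (x : X) (m : ℤ) : ModuleCat.{u} A :=
  Limits.colimit
    ((OpenNhds.inclusion (X := TopCat.of X) x).op ⋙
      (Opens.map (incl {y : X | f y < f x})).op ⋙
        reducedCohomology A (TopCat.of {y : X | f y < f x}) m)

end LocalMorse

end

/-! Write `T_{Z,x}` for the functor "stalk at `x` of `Γ_Z`" (`stalkWithSupport`). Stalks are exact,
so in degrees `n ≥ 0` local Morse data is `R^n T_{Z,x}` with `Z = {f ≥ f(x)}` (`lmdIso`).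

The first two isomorphisms are one argument. If `E` is exact, preserves injectives and satisfies
`T_{Z,y} ≅ E ⋙ T_{Z',x}`, it carries an injective resolution to one, so `R^n T_{Z,y} F ≅ R^n
T_{Z',x} (E F)` (`stalkRightDerivedIso`). This applies to the direct image `ι_*` of the closed
embedding `S → X`, where `ι_! = ι_*`, and to restriction to the open subset `V` of `S`. Constant
sheaves remain constant under inverse image.

For the last one, let `j` be the inclusion of the open set `{f < f(x)}`. An injective sheaf `J` is
flasque, so `0 → Γ_Z J → J → j_* j⁻¹ J → 0` is exact, already on sections (`support_shortExact`).
Take stalks at `x` and the long exact sequence of derived functors. The middle functor is exact, so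
only its degree `0` survives, where it gives the stalk `A`. The third has derived functors `colim_U
H^n(U ∩ {f < f(x)})`. Hence `R^{n+2} T` is this colimit for `n + 1`, while `R^1 T` and `R^0 T` are
the cokernel and kernel of `A → colim_U H^0`. Filtered colimits commute with kernels and cokernels,
which gives the colimit of reduced cohomology. -/

noncomputable section

namespace LocalMorse

open Topology Limits

/-! ### Homological algebra: derived functors of composites and of short exact sequences of
functors. -/

section Derived

variable {B C D D' : Type*} [Category* B] [Category* C] [Category* D] [Category* D']
  [Abelian B] [Abelian C] [Abelian D] [Abelian D']

/-- An exact functor commutes with the homology of cochain complexes. -/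
def homologyMapComplexIso (L : C ⥤ D) [L.Additive] [L.PreservesHomology]
    (K : CochainComplex C ℕ) (n : ℕ) :
    ((L.mapHomologicalComplex (ComplexShape.up ℕ)).obj K).homology n ≅ L.obj (K.homology n) :=
  (K.sc n).mapHomologyIso L

/-- Composing with an exact functor commutes with right derived functors. -/
def rightDerivedCompIso [HasInjectiveResolutions C] (G : C ⥤ D) [G.Additive] (L : D ⥤ D')
    [L.Additive] [L.PreservesHomology] (n : ℕ) (M : C) :
    ((G ⋙ L).rightDerived n).obj M ≅ L.obj ((G.rightDerived n).obj M) :=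
  (injectiveResolution M).isoRightDerivedObj (G ⋙ L) n ≪≫
    homologyMapComplexIso L
      ((G.mapHomologicalComplex (ComplexShape.up ℕ)).obj (injectiveResolution M).cocomplex) n ≪≫
    L.mapIso ((injectiveResolution M).isoRightDerivedObj G n).symm

/-- The image of an injective resolution under an exact functor that preserves injective
objects. -/
def mapInjectiveResolution (E : B ⥤ C) [E.Additive] [E.PreservesHomology]
    [E.PreservesInjectiveObjects] {M : B} (I : InjectiveResolution M) :
    InjectiveResolution (E.obj M) where
  cocomplex := (E.mapHomologicalComplex (ComplexShape.up ℕ)).obj I.cocomplex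
  injective n := inferInstanceAs (Injective (E.obj (I.cocomplex.X n)))
  ι := (HomologicalComplex.singleMapHomologicalComplex E (ComplexShape.up ℕ) 0).inv.app M ≫
    (E.mapHomologicalComplex (ComplexShape.up ℕ)).map I.ι
  quasiIso := inferInstance

/-- Right derived functors of the composite of an exact functor preserving injective objects and
another functor. -/
def rightDerivedPrecompIso [HasInjectiveResolutions B] [HasInjectiveResolutions C]
    (E : B ⥤ C) [E.Additive] [E.PreservesHomology]
    [E.PreservesInjectiveObjects] (G : C ⥤ D) [G.Additive] (n : ℕ) (M : B) :
    ((E ⋙ G).rightDerived n).obj M ≅ (G.rightDerived n).obj (E.obj M) :=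
  (injectiveResolution M).isoRightDerivedObj (E ⋙ G) n ≪≫
    ((mapInjectiveResolution E (injectiveResolution M)).isoRightDerivedObj G n).symm

/-- Isomorphic functors have isomorphic right derived functors. -/
def rightDerivedCongr [HasInjectiveResolutions C] {G H : C ⥤ D} [G.Additive] [H.Additive]
    (e : G ≅ H) (n : ℕ) : G.rightDerived n ≅ H.rightDerived n where
  hom := NatTrans.rightDerived e.hom n
  inv := NatTrans.rightDerived e.inv n
  hom_inv_id := by
    rw [← NatTrans.rightDerived_comp, e.hom_inv_id, NatTrans.rightDerived_id]
  inv_hom_id := by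
    rw [← NatTrans.rightDerived_comp, e.inv_hom_id, NatTrans.rightDerived_id]

/-- An exact functor keeps the resolution exact in positive degrees. -/
theorem isZero_rightDerived_of_preservesHomology [HasInjectiveResolutions C] (G : C ⥤ D)
    [G.Additive] [G.PreservesHomology] (n : ℕ) (M : C) :
    IsZero ((G.rightDerived (n + 1)).obj M) := by
  let I := injectiveResolution M
  refine IsZero.of_iso ?_ (I.isoRightDerivedObj G (n + 1) ≪≫
    homologyMapComplexIso G I.cocomplex (n + 1))
  exact G.map_isZero ((I.cocomplex_exactAt_succ n).isZero_homology)

section ShortExact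

variable {G₁ G₂ G₃ : C ⥤ D} [G₁.Additive] [G₂.Additive] [G₃.Additive]
  (α : G₁ ⟶ G₂) (β : G₂ ⟶ G₃) (w : α ≫ β = 0)

/-- The short complex of cochain complexes obtained by applying a complex of functors to a cochain
complex. -/
abbrev functorShortComplex (K : CochainComplex C ℕ) : ShortComplex (CochainComplex D ℕ) :=
  ShortComplex.mk
    ((NatTrans.mapHomologicalComplex α (ComplexShape.up ℕ)).app K)
    ((NatTrans.mapHomologicalComplex β (ComplexShape.up ℕ)).app K) (by
      ext n
      exact congrArg (fun t => t.app (K.X n)) w)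

variable (hex : ∀ (J : C) [Injective J],
  (ShortComplex.mk (α.app J) (β.app J) (congrArg (fun t => t.app J) w)).ShortExact)

-- Exactness on injective objects suffices, because the terms of the resolution are injective. For
-- an arbitrary sheaf `F`, the map `F → j_* j⁻¹ F` need not be surjective.
include hex in
theorem functorShortComplex_shortExact {M : C} (I : InjectiveResolution M) :
    (functorShortComplex α β w I.cocomplex).ShortExact :=
  HomologicalComplex.shortExact_of_degreewise_shortExact _ (fun n => hex (I.cocomplex.X n))

-- The derived functors of the exact functor `G₂` vanish on both sides of the connecting map, which
-- is therefore invertible.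
include hex in
theorem rightDerived_succ_succ_iso [HasInjectiveResolutions C] [G₂.PreservesHomology] (M : C)
    (n : ℕ) : Nonempty ((G₁.rightDerived (n + 2)).obj M ≅ (G₃.rightDerived (n + 1)).obj M) := by
  let I := injectiveResolution M
  have h := functorShortComplex_shortExact α β w hex I
  have hz (k : ℕ) := (isZero_rightDerived_of_preservesHomology G₂ k M).of_iso
    (I.isoRightDerivedObj G₂ (k + 1)).symm
  exact ⟨I.isoRightDerivedObj G₁ (n + 2) ≪≫
    (h.δIso (n + 1) (n + 2) rfl (hz n) (hz (n + 1))).symm ≪≫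
    (I.isoRightDerivedObj G₃ (n + 1)).symm⟩

/-- For a left exact functor `G`, the zeroth homology of `G(I)` is `G(M)`. -/
def homologyZeroIso (G : C ⥤ D) [G.Additive] [PreservesFiniteLimits G] {M : C}
    (I : InjectiveResolution M) :
    G.obj M ≅ ((G.mapHomologicalComplex (ComplexShape.up ℕ)).obj I.cocomplex).homology 0 :=
  asIso (I.toRightDerivedZero' G) ≪≫ (CochainComplex.isoHomologyπ₀ _)

theorem homologyZeroIso_naturality {G H : C ⥤ D} [G.Additive] [H.Additive]
    [PreservesFiniteLimits G] [PreservesFiniteLimits H] (γ : G ⟶ H) {M : C}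
    (I : InjectiveResolution M) :
    (homologyZeroIso G I).hom ≫ HomologicalComplex.homologyMap
      ((NatTrans.mapHomologicalComplex γ (ComplexShape.up ℕ)).app I.cocomplex) 0 =
    γ.app M ≫ (homologyZeroIso H I).hom := by
  have h : γ.app M ≫ I.toRightDerivedZero' H = I.toRightDerivedZero' G ≫
      HomologicalComplex.cyclesMap
        ((NatTrans.mapHomologicalComplex γ (ComplexShape.up ℕ)).app I.cocomplex) 0 := by
    rw [← cancel_mono (HomologicalComplex.iCycles _ _), Category.assoc, Category.assoc,
      InjectiveResolution.toRightDerivedZero'_comp_iCycles, HomologicalComplex.cyclesMap_i,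
      InjectiveResolution.toRightDerivedZero'_comp_iCycles_assoc]
    exact (γ.naturality (I.ι.f 0)).symm
  change (I.toRightDerivedZero' G ≫ HomologicalComplex.homologyπ _ 0) ≫ _ =
    γ.app M ≫ I.toRightDerivedZero' H ≫ HomologicalComplex.homologyπ _ 0
  rw [reassoc_of% h, Category.assoc, HomologicalComplex.homologyπ_naturality]

-- The connecting map `H⁰(G₃ I) → H¹(G₁ I)` is epi because `H¹(G₂ I) = 0`, so its target is the
-- cokernel of `H⁰(G₂ I) → H⁰(G₃ I)`. Left exactness of `G₂` and `G₃` identifies that map with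
-- `β.app M`.
include hex in
theorem rightDerived_one_iso [HasInjectiveResolutions C] [G₂.PreservesHomology]
    [PreservesFiniteLimits G₂]
    [PreservesFiniteLimits G₃] (M : C) :
    Nonempty ((G₁.rightDerived 1).obj M ≅ cokernel (β.app M)) := by
  let I := injectiveResolution M
  have h := functorShortComplex_shortExact α β w hex I
  have hz := (isZero_rightDerived_of_preservesHomology G₂ 0 M).of_iso
    (I.isoRightDerivedObj G₂ 1).symm
  have hδ : Epi (h.δ 0 1 rfl) := h.epi_δ 0 1 rfl hz
  have e := IsColimit.coconePointUniqueUpToIso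
    (h.homology_exact₃ 0 1 rfl).gIsCokernel (cokernelIsCokernel _)
  exact ⟨I.isoRightDerivedObj G₁ 1 ≪≫ e ≪≫
    (cokernel.mapIso _ _ (homologyZeroIso G₂ I) (homologyZeroIso G₃ I)
      (homologyZeroIso_naturality β I).symm).symm⟩

include hex in
theorem rightDerived_zero_iso [HasInjectiveResolutions C] [PreservesFiniteLimits G₂]
    [PreservesFiniteLimits G₃] (M : C) :
    Nonempty ((G₁.rightDerived 0).obj M ≅ kernel (β.app M)) := by
  let I := injectiveResolution M
  have h := functorShortComplex_shortExact α β w hex I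
  have : Mono (functorShortComplex α β w I.cocomplex).f := h.mono_f
  -- Nothing maps into degree `0`, so `H⁰` is the object of cycles, and the map on cycles is mono.
  have hm : Mono (HomologicalComplex.homologyMap (functorShortComplex α β w I.cocomplex).f 0) := by
    have h₁ : Mono (HomologicalComplex.cyclesMap
      (functorShortComplex α β w I.cocomplex).f 0) := inferInstance
    have h₂ := HomologicalComplex.homologyπ_naturality (functorShortComplex α β w I.cocomplex).f 0
    rw [← IsIso.eq_inv_comp] at h₂
    rw [h₂]
    infer_instance
  have e := IsLimit.conePointUniqueUpToIso
    (h.homology_exact₂ 0).fIsKernel (kernelIsKernel _)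
  exact ⟨I.isoRightDerivedObj G₁ 0 ≪≫ e ≪≫
    (kernel.mapIso _ _ (homologyZeroIso G₂ I) (homologyZeroIso G₃ I)
      (homologyZeroIso_naturality β I).symm).symm⟩

end ShortExact

end Derived

/-! ### Functors on sheaves that preserve injectives; extension by zero. -/

section Sheaves

variable {A : Type u} [CommRing A] {X Y : TopCat.{u}}

/-- Its left adjoint, sheafification, is exact. Injective sheaves can thus be tested against
monomorphisms of presheaves, which is used both for open restriction and for flasqueness. -/
instance sheafToPresheaf_preservesInjectiveObjects :
    (TopCat.Sheaf.forget (ModuleCat.{u} A) X).PreservesInjectiveObjects where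
  injective_obj {F} h := (sheafificationAdjunction (Opens.grothendieckTopology X)
    (ModuleCat.{u} A)).map_injective F h

instance pullback_preservesFiniteLimits (f : X ⟶ Y) :
    PreservesFiniteLimits (TopCat.Sheaf.pullback (ModuleCat.{u} A) f) := by
  have := @reflectsLimits_of_reflectsIsomorphisms
  exact Functor.sheafPullbackConstruction.preservesFiniteLimits (Opens.map f) _ _ _

instance pushforward_preservesInjectiveObjects (f : X ⟶ Y) :
    (TopCat.Sheaf.pushforward (ModuleCat.{u} A) f).PreservesInjectiveObjects where
  injective_obj {F} h :=
    (TopCat.Sheaf.pullbackPushforwardAdjunction (ModuleCat.{u} A) f).map_injective F h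

/-- Restriction of sheaves along an open embedding. -/
abbrev openRestrict (A : Type u) [CommRing A] {f : X ⟶ Y} (hf : IsOpenEmbedding f) :
    TopCat.Sheaf (ModuleCat.{u} A) Y ⥤ TopCat.Sheaf (ModuleCat.{u} A) X :=
  hf.sheafPullback (ModuleCat.{u} A)

variable {f : X ⟶ Y} (hf : IsOpenEmbedding f)

instance : PreservesFiniteLimits (openRestrict A hf) :=
  preservesFiniteLimits_of_natIso (hf.sheafPullbackIso (ModuleCat.{u} A))

instance : (openRestrict A hf).IsLeftAdjoint :=
  Functor.isLeftAdjoint_of_iso (hf.sheafPullbackIso (ModuleCat.{u} A))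

instance : (openRestrict A hf).Additive where
  map_add := rfl

/-- Extension by zero, as a presheaf, along an open embedding `f`: the subpresheaf of `f_* G` of
the sections over `U` that vanish unless `U` is contained in the image of `f`. -/
def extZeroFamily (f : X ⟶ Y) (G : TopCat.Sheaf (ModuleCat.{u} A) X) :
    SubFamily ((TopCat.Sheaf.pushforward (ModuleCat.{u} A) f).obj G) where
  carrier U :=
    { carrier := {s | ¬ (U : Set Y) ⊆ Set.range f → s = 0}
      zero_mem' := fun _ => rfl
      add_mem' := fun hs ht h => by rw [hs h, ht h, add_zero]
      smul_mem' := fun a s hs h => by rw [hs h, smul_zero] }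
  res i s hs h := by
    have : s = 0 := hs (fun h' => h (subset_trans i.le h'))
    rw [this, map_zero]

/-- The functoriality of extension by zero. -/
def extZeroMap (f : X ⟶ Y) {G H : TopCat.Sheaf (ModuleCat.{u} A) X} (φ : G ⟶ H) :
    (extZeroFamily f G).presheaf ⟶ (extZeroFamily f H).presheaf where
  app U := ModuleCat.ofHom ((φ.1.app (op ((Opens.map f).obj U.unop))).hom.restrict
    (fun s hs h => by
      exact (congrArg _ (hs h)).trans (map_zero _)))
  naturality U V i := by
    ext s
    exact Subtype.ext (NatTrans.naturality_apply φ.1 ((Opens.map f).map i.unop).op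
      (show (extZeroFamily f G).carrier U.unop from s).1)

instance {G H : TopCat.Sheaf (ModuleCat.{u} A) X} (φ : G ⟶ H) [Mono φ] :
    Mono (extZeroMap f φ) := by
  have h1 : Mono ((TopCat.Sheaf.forget (ModuleCat.{u} A) X).map φ) := inferInstance
  have h2 := (NatTrans.mono_iff_mono_app ((TopCat.Sheaf.forget (ModuleCat.{u} A) X).map φ)).1 h1
  refine (NatTrans.mono_iff_mono_app _).2 (fun U => (ModuleCat.mono_iff_injective _).2 ?_)
  intro s t hst
  have h3 := (ModuleCat.mono_iff_injective _).1 (h2 (op ((Opens.map f).obj U.unop)))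
  exact Subtype.ext (h3 (congrArg Subtype.val hst))

theorem map_functor_le (V : Opens X) : (Opens.map f).obj (hf.functor.obj V) ≤ V :=
  (Set.preimage_image_eq (V : Set X) hf.injective).le

theorem le_functor_map {U : Opens Y} (h : (U : Set Y) ⊆ Set.range f) :
    U ≤ hf.functor.obj ((Opens.map f).obj U) := by
  intro y hy
  obtain ⟨x, rfl⟩ := h hy
  exact ⟨x, hy, rfl⟩

/-- A sheaf `G` on the source of an open embedding is contained in the restriction of its
extension by zero. -/
def toExtZero (G : TopCat.Sheaf (ModuleCat.{u} A) X) :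
    G.presheaf ⟶ hf.functor.op ⋙ (extZeroFamily f G).presheaf where
  app V := ModuleCat.ofHom (LinearMap.codRestrict _
    (G.presheaf.map (homOfLE (map_functor_le hf V.unop)).op).hom
    (fun s h => (h (Set.image_subset_range _ _)).elim))
  naturality V W i := by
    ext s
    refine Subtype.ext ?_
    change (G.presheaf.map i ≫ G.presheaf.map _) s = (G.presheaf.map _ ≫ G.presheaf.map _) s
    rw [← G.presheaf.map_comp, ← G.presheaf.map_comp]
    rfl

theorem toExtZero_naturality {G H : TopCat.Sheaf (ModuleCat.{u} A) X} (φ : G ⟶ H) :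
    toExtZero hf G ≫ Functor.whiskerLeft hf.functor.op (extZeroMap f φ) =
      φ.1 ≫ toExtZero hf H := by
  ext V s
  exact Subtype.ext (NatTrans.naturality_apply φ.1 _ s)

open Classical in
/-- A morphism from `G` to the restriction of `F` extends to the extension by zero of `G`. -/
def extZeroLift {G : TopCat.Sheaf (ModuleCat.{u} A) X} {F : TopCat.Sheaf (ModuleCat.{u} A) Y}
    (φ : G ⟶ (openRestrict A hf).obj F) : (extZeroFamily f G).presheaf ⟶ F.presheaf where
  app U := if h : (U.unop : Set Y) ⊆ Set.range f then
      ModuleCat.ofHom (Submodule.subtype _) ≫ φ.1.app (op ((Opens.map f).obj U.unop)) ≫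
        F.presheaf.map (homOfLE (le_functor_map hf h)).op
    else 0
  naturality U V i := by
    by_cases hU : (U.unop : Set Y) ⊆ Set.range f
    · have hV : (V.unop : Set Y) ⊆ Set.range f := subset_trans i.unop.le hU
      rw [dif_pos hU, dif_pos hV]
      ext s
      obtain ⟨s, hs⟩ := s
      change F.presheaf.map _ (φ.1.app _ (G.presheaf.map ((Opens.map f).map i.unop).op s)) =
        F.presheaf.map _ (F.presheaf.map _ (φ.1.app _ s))
      refine (congrArg _ (NatTrans.naturality_apply φ.1 ((Opens.map f).map i.unop).op s)).trans ?_
      change (F.presheaf.map _ ≫ F.presheaf.map _) _ = (F.presheaf.map _ ≫ F.presheaf.map _) _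
      rw [← F.presheaf.map_comp, ← F.presheaf.map_comp]
      rfl
    · rw [dif_neg hU, zero_comp]
      ext s
      have hs : s = 0 := Subtype.ext ((show (extZeroFamily f G).carrier U.unop from s).2 hU)
      rw [hs]
      exact map_zero _

/-- The part of the adjunction between extension by zero and restriction that the extension argument
needs; uniqueness of the lift plays no role. -/
theorem toExtZero_extZeroLift {G : TopCat.Sheaf (ModuleCat.{u} A) X}
    {F : TopCat.Sheaf (ModuleCat.{u} A) Y} (φ : G ⟶ (openRestrict A hf).obj F) :
    toExtZero hf G ≫ Functor.whiskerLeft hf.functor.op (extZeroLift hf φ) = φ.1 := by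
  ext V s
  have h : (hf.functor.obj V : Set Y) ⊆ Set.range f := Set.image_subset_range _ _
  change (extZeroLift hf φ).app (op (hf.functor.obj V)) _ = _
  rw [extZeroLift]
  dsimp only
  rw [dif_pos h]
  change F.presheaf.map _ (φ.1.app _ (G.presheaf.map _ s)) = _
  refine (congrArg _ (NatTrans.naturality_apply φ.1 (homOfLE (map_functor_le hf V)).op s)).trans ?_
  change (F.presheaf.map _ ≫ F.presheaf.map _) _ = _
  rw [← F.presheaf.map_comp]
  exact congrArg (fun t => t.hom (φ.1.app (op V) s))
    (F.presheaf.map_id (op (hf.functor.obj V)))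

/-- To extend `φ : G → F|_X` along a mono `m : G → H`, pass to the extensions by zero, where `m`
stays mono. Since `F` is injective as a presheaf, the lift of `φ` extends there, and restricting
back gives the answer. No sheafification of the extension by zero is needed. -/
instance openRestrict_preservesInjectiveObjects :
    (openRestrict A hf).PreservesInjectiveObjects where
  injective_obj {F} hF := by
    have hF' : Injective F.presheaf :=
      (TopCat.Sheaf.forget (ModuleCat.{u} A) Y).injective_obj_of_injective hF
    refine ⟨fun {G H} φ m _ => ?_⟩
    obtain ⟨ψ, hψ⟩ := hF'.factors (extZeroLift hf φ) (extZeroMap f m)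
    refine ⟨⟨toExtZero hf H ≫ Functor.whiskerLeft hf.functor.op ψ⟩, ?_⟩
    apply CategoryTheory.Sheaf.hom_ext
    refine (Category.assoc m.1 (toExtZero hf H) (Functor.whiskerLeft hf.functor.op ψ)).symm.trans ?_
    refine (congrArg (· ≫ Functor.whiskerLeft hf.functor.op ψ)
      (toExtZero_naturality hf m).symm).trans ?_
    refine (Category.assoc _ _ _).trans ?_
    exact (congrArg (fun t => toExtZero hf G ≫ Functor.whiskerLeft hf.functor.op t) hψ).trans
      (toExtZero_extZeroLift hf φ)

end Sheaves

/-! ### Injective sheaves are flasque. -/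

section Flasque

variable {A : Type u} [CommRing A] {X : TopCat.{u}}

/-- The free presheaf of modules on one generator over an open subset. -/
abbrev freeYoneda (A : Type u) [CommRing A] (U : Opens X) : TopCat.Presheaf (ModuleCat.{u} A) X :=
  yoneda.obj U ⋙ ModuleCat.free A

/-- The morphism from the free presheaf given by a section. -/
def freeYonedaDesc (F : TopCat.Presheaf (ModuleCat.{u} A) X) {U : Opens X}
    (s : F.obj (op U)) : freeYoneda A U ⟶ F where
  app W := ModuleCat.freeDesc (↾(fun (h : W.unop ⟶ U) => F.map h.op s))
  naturality V W i := by
    apply ModuleCat.free_hom_ext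
    intro h
    change ModuleCat.freeDesc _ ((ModuleCat.free A).map _ _) = F.map i (ModuleCat.freeDesc _ _)
    rw [ModuleCat.free_map_apply, ModuleCat.freeDesc_apply, ModuleCat.freeDesc_apply]
    change F.map _ s = (F.map _ ≫ F.map i) s
    rw [← F.map_comp]
    rfl

/-- The inclusion of free presheaves given by an inclusion of open subsets. -/
abbrev freeYonedaMap (A : Type u) [CommRing A] {U V : Opens X} (i : V ⟶ U) :
    freeYoneda A V ⟶ freeYoneda A U :=
  Functor.whiskerRight (yoneda.map i) (ModuleCat.free A)

/-- There is at most one inclusion `W ⟶ V`, so the map on bases is injective. -/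
theorem freeYonedaMap_mono {U V : Opens X} (i : V ⟶ U) : Mono (freeYonedaMap A i) := by
  refine (NatTrans.mono_iff_mono_app _).2 (fun W => ?_)
  refine (ModuleCat.mono_iff_injective _).2 ?_
  refine Finsupp.mapDomain_injective ?_
  intro (a : W.unop ⟶ V) (b : W.unop ⟶ V) _
  exact Subsingleton.elim a b

/-- A section over `V` is a morphism from the free presheaf on `V`. Extending it to the free
presheaf on `U` and evaluating at the generator extends the section. -/
theorem map_surjective_of_injective {F : TopCat.Sheaf (ModuleCat.{u} A) X} (hF : Injective F)
    {U V : Opens X} (i : V ⟶ U) : Function.Surjective (F.presheaf.map i.op) := by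
  have hF' : Injective F.presheaf :=
    (TopCat.Sheaf.forget (ModuleCat.{u} A) X).injective_obj_of_injective hF
  intro s
  have := freeYonedaMap_mono (A := A) i
  obtain ⟨ψ, hψ⟩ := hF'.factors (freeYonedaDesc F.presheaf s) (freeYonedaMap A i)
  refine ⟨ψ.app (op U) (ModuleCat.freeMk (𝟙 U)), ?_⟩
  rw [← NatTrans.naturality_apply]
  have h := congrArg (fun t => t.app (op V) (ModuleCat.freeMk (𝟙 V))) hψ
  have h2 : (freeYonedaDesc F.presheaf s).app (op V) (ModuleCat.freeMk (𝟙 V)) = s := by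
    refine (ModuleCat.freeDesc_apply _ _).trans ?_
    exact congrArg (fun t => t.hom s) (F.presheaf.map_id (op V))
  refine Eq.trans ?_ (h.trans h2)
  refine congrArg (ψ.app (op V)) ?_
  refine (ModuleCat.free_map_apply _ _).trans ?_
  refine Eq.trans ?_ (ModuleCat.free_map_apply _ _).symm
  rfl

end Flasque

/-! ### Sections with support under open restriction and closed direct image. -/

section Support

variable {A : Type u} [CommRing A] {X Y : TopCat.{u}}

/-- Restricting a section to two equal open subsets. -/
theorem map_eq_zero_iff_of_eq (F : TopCat.Presheaf (ModuleCat.{u} A) X) {U V W : Opens X}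
    (h : V = W) (i : V ⟶ U) (j : W ⟶ U) (s : F.obj (op U)) :
    F.map i.op s = 0 ↔ F.map j.op s = 0 := by
  subst h
  rw [Subsingleton.elim i j]

/-- The stalk at `x` of the sections supported in `Z`. -/
abbrev stalkWithSupport (A : Type u) [CommRing A] (Z : Closeds X) (x : X) :
    TopCat.Sheaf (ModuleCat.{u} A) X ⥤ ModuleCat.{u} A :=
  sectionsWithSupport A Z ⋙ TopCat.Sheaf.forget (ModuleCat.{u} A) X ⋙
    TopCat.Presheaf.stalkFunctor (ModuleCat.{u} A) x

section OpenRestrict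

variable {f : X ⟶ Y} (hf : IsOpenEmbedding f) {Z : Closeds Y} {Z' : Closeds X}
  (hZ : ∀ x, x ∈ Z' ↔ f x ∈ Z)

include hZ in
theorem openRestrict_supportedFamily (F : TopCat.Sheaf (ModuleCat.{u} A) Y) (U : Opens X) :
    (supportedFamily Z F).carrier (hf.functor.obj U) =
      (supportedFamily Z' ((openRestrict A hf).obj F)).carrier U := by
  ext s
  refine map_eq_zero_iff_of_eq F.presheaf (W := hf.functor.obj (U ⊓ Z'.compl)) ?_ _
    (hf.functor.map (homOfLE inf_le_left)) s
  ext y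
  constructor
  · rintro ⟨⟨x, hx, rfl⟩, hy⟩
    exact ⟨x, ⟨hx, fun h => hy ((hZ x).1 h)⟩, rfl⟩
  · rintro ⟨x, ⟨hx, hxZ⟩, rfl⟩
    exact ⟨⟨x, hx, rfl⟩, fun h => hxZ ((hZ x).2 h)⟩

/-- Sections with support commute with restriction to open subsets. -/
def openRestrictSectionsWithSupportIso :
    sectionsWithSupport A Z ⋙ TopCat.Sheaf.forget (ModuleCat.{u} A) Y ⋙
        (Functor.whiskeringLeft _ _ _).obj hf.functor.op ≅
      openRestrict A hf ⋙ sectionsWithSupport A Z' ⋙ TopCat.Sheaf.forget (ModuleCat.{u} A) X :=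
  NatIso.ofComponents (fun F => NatIso.ofComponents (fun U =>
      (LinearEquiv.ofEq _ _ (openRestrict_supportedFamily hf hZ F U.unop)).toModuleIso)
      (fun _ => rfl))
    (fun _ => rfl)

/-- The stalk of the restriction to an open subset. -/
def openRestrictStalkIso (x : X) :
    TopCat.Presheaf.stalkFunctor (ModuleCat.{u} A) (f x) ≅
      (Functor.whiskeringLeft _ _ _).obj hf.functor.op ⋙
        TopCat.Presheaf.stalkFunctor (ModuleCat.{u} A) x :=
  -- Image is left adjoint to preimage on neighbourhoods, hence initial: images of neighbourhoods of
  -- `x` are cofinal among those of `f x`.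
  haveI := Functor.initial_of_adjunction (hf.adjunctionNhds x)
  ((Functor.whiskeringLeft _ _ _).obj (OpenNhds.inclusion (f x)).op).isoWhiskerLeft
    (Functor.Final.colimIso (hf.functorNhds x).op).symm

/-- The stalk of the sections with support commutes with restriction to open subsets. -/
def openRestrictStalkWithSupportIso (x : X) :
    stalkWithSupport A Z (f x) ≅ openRestrict A hf ⋙ stalkWithSupport A Z' x :=
  (sectionsWithSupport A Z ⋙ TopCat.Sheaf.forget (ModuleCat.{u} A) Y).isoWhiskerLeft
      (openRestrictStalkIso hf x) ≪≫
    Functor.isoWhiskerRight (openRestrictSectionsWithSupportIso hf hZ)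
      (TopCat.Presheaf.stalkFunctor (ModuleCat.{u} A) x)

end OpenRestrict

section Pushforward

variable (f : X ⟶ Y) {Z : Closeds Y} {Z' : Closeds X}
  (hZ : ∀ x, x ∈ Z' ↔ f x ∈ Z)

include hZ in
theorem pushforward_supportedFamily (F : TopCat.Sheaf (ModuleCat.{u} A) X) (U : Opens Y) :
    (supportedFamily Z ((TopCat.Sheaf.pushforward (ModuleCat.{u} A) f).obj F)).carrier U =
      (supportedFamily Z' F).carrier ((Opens.map f).obj U) := by
  ext s
  refine map_eq_zero_iff_of_eq F.presheaf ?_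
    ((Opens.map f).map (homOfLE (inf_le_left : U ⊓ Z.compl ≤ U))) (homOfLE inf_le_left) s
  ext x
  exact and_congr_right (fun _ => not_congr (hZ x).symm)

/-- Sections with support commute with direct images. -/
def pushforwardSectionsWithSupportIso :
    TopCat.Sheaf.pushforward (ModuleCat.{u} A) f ⋙ sectionsWithSupport A Z ⋙
        TopCat.Sheaf.forget (ModuleCat.{u} A) Y ≅
      sectionsWithSupport A Z' ⋙ TopCat.Sheaf.forget (ModuleCat.{u} A) X ⋙
        TopCat.Presheaf.pushforward (ModuleCat.{u} A) f :=
  NatIso.ofComponents (fun F => NatIso.ofComponents (fun U =>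
      (LinearEquiv.ofEq _ _ (pushforward_supportedFamily f hZ F U.unop)).toModuleIso)
      (fun _ => rfl))
    (fun _ => rfl)

variable {f} (hf : IsInducing f)

/-- The stalk of the direct image along a topological embedding. -/
def pushforwardStalkIso (x : X) :
    TopCat.Presheaf.pushforward (ModuleCat.{u} A) f ⋙
        TopCat.Presheaf.stalkFunctor (ModuleCat.{u} A) (f x) ≅
      TopCat.Presheaf.stalkFunctor (ModuleCat.{u} A) x :=
  -- For an inducing map, preimages of neighbourhoods of `f x` are cofinal among the neighbourhoods
  -- of `x`.
  haveI := Functor.initial_of_adjunction (hf.adjunctionNhds x)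
  ((Functor.whiskeringLeft _ _ _).obj (OpenNhds.inclusion x).op).isoWhiskerLeft
    (Functor.Final.colimIso (OpenNhds.map f x).op)

/-- The stalk of the sections with support commutes with direct images along embeddings. -/
def pushforwardStalkWithSupportIso (x : X) :
    stalkWithSupport A Z' x ≅
      TopCat.Sheaf.pushforward (ModuleCat.{u} A) f ⋙ stalkWithSupport A Z (f x) :=
  (sectionsWithSupport A Z' ⋙ TopCat.Sheaf.forget (ModuleCat.{u} A) X).isoWhiskerLeft
      (pushforwardStalkIso hf x).symm ≪≫
    Functor.isoWhiskerRight (pushforwardSectionsWithSupportIso f hZ).symm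
      (TopCat.Presheaf.stalkFunctor (ModuleCat.{u} A) (f x))

instance : (TopCat.Sheaf.pushforward (ModuleCat.{u} A) f).Additive where
  map_add := rfl

/-- Epimorphisms are local surjections. At a point of the image, a neighbourhood in `X` on which a
lift exists is the trace of one in `Y`. Off the image, closedness gives a neighbourhood whose
preimage is empty. -/
theorem pushforward_preservesEpimorphisms (hf : IsClosedEmbedding f) :
    (TopCat.Sheaf.pushforward (ModuleCat.{u} A) f).PreservesEpimorphisms where
  preserves {F G} φ hφ := by
    refine (TopCat.Sheaf.isLocallySurjective_iff_epi _).1 ?_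
    have hφ' := (TopCat.Sheaf.isLocallySurjective_iff_epi φ).2 hφ
    rw [TopCat.Presheaf.isLocallySurjective_iff] at hφ' ⊢
    intro U t y hy
    by_cases hyf : y ∈ Set.range f
    · obtain ⟨x, rfl⟩ := hyf
      obtain ⟨V, hV, ⟨s, hs⟩, hxV⟩ := hφ' ((Opens.map f).obj U) t x hy
      obtain ⟨V', hV', hVV'⟩ := hf.isInducing.isOpen_iff.1 V.2
      have hW : (Opens.map f).obj (U ⊓ ⟨V', hV'⟩) ≤ V := fun z hz => hVV'.subset hz.2
      refine ⟨U ⊓ ⟨V', hV'⟩, inf_le_left, ⟨F.presheaf.map (homOfLE hW).op s, ?_⟩, hy,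
        hVV'.superset hxV⟩
      refine (NatTrans.naturality_apply φ.1 (homOfLE hW).op s).trans ?_
      rw [hs]
      change (G.presheaf.map _ ≫ G.presheaf.map _) t = G.presheaf.map _ t
      rw [← G.presheaf.map_comp]
      rfl
    · let N : Opens Y := ⟨(Set.range f)ᶜ, hf.isClosed_range.isOpen_compl⟩
      refine ⟨U ⊓ N, inf_le_left, ⟨0, ?_⟩, hy, hyf⟩
      -- The preimage of `U ⊓ N` is covered by the empty family, so any two sections over it agree.
      refine TopCat.Sheaf.eq_of_locally_eq' G (ι := PEmpty.{u+1}) (fun i => i.elim)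
        ((Opens.map f).obj (U ⊓ N)) (fun i => i.elim) ?_ _ _ (fun i => i.elim)
      rintro x ⟨-, hx⟩
      exact (hx ⟨x, rfl⟩).elim

theorem pushforward_preservesHomology (hf : IsClosedEmbedding f) :
    (TopCat.Sheaf.pushforward (ModuleCat.{u} A) f).PreservesHomology := by
  have := pushforward_preservesEpimorphisms (A := A) hf
  have : (TopCat.Sheaf.pushforward (ModuleCat.{u} A) f).PreservesZeroMorphisms := ⟨fun _ _ => rfl⟩
  exact Functor.preservesHomology_of_preservesEpis_and_kernels _

end Pushforward

section MorseData

/-- Right derived functors of sections with support at a point, for an exact functor `E` which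
preserves injective objects and is compatible with sections with support. -/
def stalkRightDerivedIso {Z : Closeds Y} {Z' : Closeds X} {y : Y} {x : X}
    (E : TopCat.Sheaf (ModuleCat.{u} A) Y ⥤ TopCat.Sheaf (ModuleCat.{u} A) X) [E.Additive]
    [E.PreservesHomology] [E.PreservesInjectiveObjects]
    (e : stalkWithSupport A Z y ≅ E ⋙ stalkWithSupport A Z' x) (n : ℕ)
    (F : TopCat.Sheaf (ModuleCat.{u} A) Y) :
    ((stalkWithSupport A Z y).rightDerived n).obj F ≅
      ((stalkWithSupport A Z' x).rightDerived n).obj (E.obj F) :=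
  (rightDerivedCongr e n).app F ≪≫ rightDerivedPrecompIso E _ n F

variable {X Y : Type u} [TopologicalSpace X] [TopologicalSpace Y]

/-- Local Morse data as a right derived functor. -/
def lmdIso (F : TopCat.Sheaf (ModuleCat.{u} A) (TopCat.of X)) (f : C(X, ℝ)) (x : X) (n : ℕ) :
    LMD F f x (Int.ofNat n) ≅
      ((stalkWithSupport A (superlevel f x) x).rightDerived n).obj F :=
  (rightDerivedCompIso (sectionsWithSupport A (superlevel f x))
    (TopCat.Sheaf.forget (ModuleCat.{u} A) (TopCat.of X) ⋙
      TopCat.Presheaf.stalkFunctor (X := TopCat.of X) (ModuleCat.{u} A) x) n F).symm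

theorem lmd_congr {F G : TopCat.Sheaf (ModuleCat.{u} A) (TopCat.of X)} (e : F ≅ G) (f : C(X, ℝ))
    (x : X) (i : ℤ) : Nonempty (LMD F f x i ≅ LMD G f x i) := by
  obtain n | n := i
  · exact ⟨lmdIso F f x n ≪≫ ((stalkWithSupport A (superlevel f x) x).rightDerived n).mapIso e ≪≫
      (lmdIso G f x n).symm⟩
  · exact ⟨Iso.refl _⟩

theorem lmd_pushforward (ι : C(X, Y)) (hι : IsClosedEmbedding ι) (f : C(Y, ℝ)) (x : X)
    (F : TopCat.Sheaf (ModuleCat.{u} A) (TopCat.of X)) (i : ℤ) :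
    Nonempty (LMD ((TopCat.Sheaf.pushforward (ModuleCat.{u} A) (TopCat.ofHom ι)).obj F) f (ι x) i ≅
      LMD F (f.comp ι) x i) := by
  obtain n | n := i
  · have := pushforward_preservesHomology (A := A) (f := TopCat.ofHom ι) hι
    exact ⟨lmdIso _ f (ι x) n ≪≫ (stalkRightDerivedIso _
      (pushforwardStalkWithSupportIso (f := TopCat.ofHom ι) (Z := superlevel f (ι x))
        (Z' := superlevel (f.comp ι) x) (fun _ => Iff.rfl) hι.isInducing x) n F).symm ≪≫
      (lmdIso F (f.comp ι) x n).symm⟩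
  · exact ⟨Iso.refl _⟩

theorem lmd_openRestrict (ι : C(X, Y)) (hι : IsOpenEmbedding ι) (f : C(Y, ℝ)) (x : X)
    (F : TopCat.Sheaf (ModuleCat.{u} A) (TopCat.of Y)) (i : ℤ) :
    Nonempty (LMD F f (ι x) i ≅
      LMD ((openRestrict A (f := TopCat.ofHom ι) hι).obj F) (f.comp ι) x i) := by
  obtain n | n := i
  · exact ⟨lmdIso _ f (ι x) n ≪≫ stalkRightDerivedIso _
      (openRestrictStalkWithSupportIso (f := TopCat.ofHom ι) hι (fun _ => Iff.rfl) x) n F ≪≫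
      (lmdIso _ (f.comp ι) x n).symm⟩
  · exact ⟨Iso.refl _⟩

end MorseData

end Support

/-! ### Constant sheaves, and `ι_! = ι_*` for closed embeddings. -/

section Constant

variable {A : Type u} [CommRing A] {X Y : TopCat.{u}}

/-- The inverse image of a constant sheaf is constant. -/
def pullbackConstSheafIso (A : Type u) [CommRing A] (f : X ⟶ Y) :
    (TopCat.Sheaf.pullback (ModuleCat.{u} A) f).obj (constSheaf A Y) ≅ constSheaf A X :=
  -- Global sections of `f_* F` are those of `F`, so both sides are left adjoint to global sections
  -- on `X`.
  (((constantSheafAdj (Opens.grothendieckTopology Y) (ModuleCat.{u} A)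
      (T := (⊤ : Opens Y)) isTerminalTop).comp
    (TopCat.Sheaf.pullbackPushforwardAdjunction (ModuleCat.{u} A) f)).leftAdjointUniq
    (constantSheafAdj (Opens.grothendieckTopology X) (ModuleCat.{u} A)
      (T := (⊤ : Opens X)) isTerminalTop)).app (ModuleCat.of A A)

/-- The restriction of a constant sheaf to an open subset is constant. -/
def openRestrictConstSheafIso (A : Type u) [CommRing A] {f : X ⟶ Y} (hf : IsOpenEmbedding f) :
    constSheaf A X ≅ (openRestrict A hf).obj (constSheaf A Y) :=
  haveI := hf.functor_isContinuous
  haveI : hf.functor.IsCocontinuous (Opens.grothendieckTopology X)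
      (Opens.grothendieckTopology Y) := by
    rw [hf.isOpenMap.adjunction.isCocontinuous_iff_coverPreserving]
    exact coverPreserving_opens_map f
  (hf.functor.pushforwardContinuousSheafificationCompatibility (ModuleCat.{u} A)
    (Opens.grothendieckTopology X) (Opens.grothendieckTopology Y)).app
      ((Functor.const _).obj (ModuleCat.of A A))

/-- Compatibility with constant sections is what later identifies the augmentation with the
restriction map on stalks. -/
theorem constSection_openRestrictConstSheafIso {f : X ⟶ Y} (hf : IsOpenEmbedding f) :
    constSection A X ≫ (openRestrictConstSheafIso A hf).hom.1 =
      Functor.whiskerLeft hf.functor.op (constSection A Y) := by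
  have := hf.functor_isContinuous
  have : hf.functor.IsCocontinuous (Opens.grothendieckTopology X)
      (Opens.grothendieckTopology Y) := by
    rw [hf.isOpenMap.adjunction.isCocontinuous_iff_coverPreserving]
    exact coverPreserving_opens_map f
  exact hf.functor.toSheafify_pullbackSheafificationCompatibility (ModuleCat.{u} A)
    (Opens.grothendieckTopology X) (Opens.grothendieckTopology Y)
      ((Functor.const _).obj (ModuleCat.of A A))

theorem stalk_constSection_isIso (x : X) :
    IsIso ((TopCat.Presheaf.stalkFunctor (ModuleCat.{u} A) x).map (constSection A X)) :=
  TopCat.Presheaf.stalkFunctor_map_unit_toSheafify_isIso x _ _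

/-- The support is closed in `f⁻¹(U)`, and `f⁻¹(U) → U` is a closed embedding; the composite is a
closed embedding, hence proper. -/
theorem hasProperSupport_of_isClosedEmbedding {f : X ⟶ Y} (hf : IsClosedEmbedding f)
    (G : TopCat.Sheaf (ModuleCat.{u} A) X) (U : Opens Y)
    (s : G.presheaf.obj (op ((Opens.map f).obj U))) : HasProperSupport f G U s := by
  obtain ⟨C, hC, hCs⟩ := isClosed_supp_inter G (U := (Opens.map f).obj U) s
  have h₁ : IsClosedEmbedding (Set.inclusion (supp_subset G s)) := by
    refine ⟨IsEmbedding.inclusion _, ?_⟩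
    rw [Set.range_inclusion]
    refine isClosed_induced_iff.2 ⟨C, hC, ?_⟩
    ext x
    exact ⟨fun hx => hCs.superset ⟨hx, x.2⟩, fun hx => (hCs.subset hx).1⟩
  have h₂ : IsClosedEmbedding ((U : Set Y).restrictPreimage f) := hf.restrictPreimage _
  exact (h₂.comp h₁).isProperMap

/-- The direct image with proper supports along a closed embedding is the direct image. -/
def properPushforwardIso [T2Space Y] [LocallyCompactSpace Y] {f : X ⟶ Y}
    (hf : IsClosedEmbedding f) (G : TopCat.Sheaf (ModuleCat.{u} A) X) :
    properPushforward f G ≅ (TopCat.Sheaf.pushforward (ModuleCat.{u} A) f).obj G :=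
  (fullyFaithfulSheafToPresheaf (Opens.grothendieckTopology Y) (ModuleCat.{u} A)).preimageIso
    (NatIso.ofComponents (fun U => (LinearEquiv.ofTop _ (by
      rw [eq_top_iff]
      exact fun s _ => hasProperSupport_of_isClosedEmbedding hf G U.unop s)).toModuleIso)
      (fun _ => rfl))

/-- For `S` closed, `(A_X)_S` is the direct image of the constant sheaf on `S`. -/
def cutOffConstSheafIso (A : Type u) [CommRing A] {X : Type u} [TopologicalSpace X] [T2Space X]
    [LocallyCompactSpace X] {S : Set X} (hS : IsClosed S) :
    cutOff (constSheaf A (TopCat.of X)) S ≅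
      (TopCat.Sheaf.pushforward (ModuleCat.{u} A) (incl S)).obj (constSheaf A (TopCat.of S)) :=
  haveI : T2Space (TopCat.of X) := ‹T2Space X›
  haveI : LocallyCompactSpace (TopCat.of X) := ‹LocallyCompactSpace X›
  properPushforwardIso (f := incl S) hS.isClosedEmbedding_subtypeVal _ ≪≫
    (TopCat.Sheaf.pushforward (ModuleCat.{u} A) (incl S)).mapIso (pullbackConstSheafIso A (incl S))

end Constant

theorem shortExact_of_evaluation {C D : Type*} [Category* C] [Category* D] [Abelian D]
    (S : ShortComplex (C ⥤ D)) (h : ∀ W, (S.map ((evaluation C D).obj W)).ShortExact) :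
    S.ShortExact where
  exact := by
    rw [ShortComplex.exact_iff_isZero_homology, Functor.isZero_iff]
    intro W
    exact (((S.map _).exact_iff_isZero_homology).1 (h W).exact).of_iso
      (S.mapHomologyIso ((evaluation C D).obj W)).symm
  mono_f := (NatTrans.mono_iff_mono_app _).2 fun W => (h W).mono_f
  epi_g := (NatTrans.epi_iff_epi_app _).2 fun W => (h W).epi_g

/-! ### Cohomology presheaves and the exact sequence of sections with support. -/

section Comparison

variable {A : Type u} [CommRing A] {X Y : TopCat.{u}}

instance (x : X) : PreservesFiniteLimits (TopCat.Presheaf.stalkFunctor (ModuleCat.{u} A) x) :=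
  comp_preservesFiniteLimits ((Functor.whiskeringLeft _ _ _).obj (OpenNhds.inclusion x).op) colim

instance (f : X ⟶ Y) : PreservesFiniteLimits (TopCat.Presheaf.pushforward (ModuleCat.{u} A) f) :=
  inferInstanceAs (PreservesFiniteLimits ((Functor.whiskeringLeft _ _ _).obj _))

instance (f : X ⟶ Y) : PreservesFiniteColimits (TopCat.Presheaf.pushforward (ModuleCat.{u} A) f) :=
  inferInstanceAs (PreservesFiniteColimits ((Functor.whiskeringLeft _ _ _).obj _))

instance (f : X ⟶ Y) : (TopCat.Presheaf.pushforward (ModuleCat.{u} A) f).Additive where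
  map_add := rfl

/-- Evaluation of presheaves at an open subset. -/
def presheafEval (A : Type u) [CommRing A] (W : (Opens X)ᵒᵖ) :
    TopCat.Presheaf (ModuleCat.{u} A) X ⥤ ModuleCat.{u} A :=
  (evaluation (Opens X)ᵒᵖ (ModuleCat.{u} A)).obj W

instance (W : (Opens X)ᵒᵖ) : PreservesFiniteLimits (presheafEval A W) :=
  inferInstanceAs (PreservesFiniteLimits ((evaluation (Opens X)ᵒᵖ (ModuleCat.{u} A)).obj W))

instance (W : (Opens X)ᵒᵖ) : PreservesFiniteColimits (presheafEval A W) :=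
  inferInstanceAs (PreservesFiniteColimits ((evaluation (Opens X)ᵒᵖ (ModuleCat.{u} A)).obj W))

instance (W : (Opens X)ᵒᵖ) : (presheafEval A W).Additive where
  map_add := rfl

instance (W : (Opens X)ᵒᵖ) : PreservesFiniteLimits (sections A W) :=
  comp_preservesFiniteLimits (TopCat.Sheaf.forget (ModuleCat.{u} A) X) (presheafEval A W)

instance (F : TopCat.Sheaf (ModuleCat.{u} A) X) : IsIso (toCohomologyZero F) := by
  have (W : (Opens X)ᵒᵖ) : IsIso ((toCohomologyZero F).app W) :=
    inferInstanceAs (IsIso ((sections A W).toRightDerivedZero.app F))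
  exact NatIso.isIso_of_isIso_app _

/-- The presheaf of cohomology as a right derived functor with values in presheaves. -/
def cohomologyIso (F : TopCat.Sheaf (ModuleCat.{u} A) X) (n : ℕ) :
    ((TopCat.Sheaf.forget (ModuleCat.{u} A) X).rightDerived n).obj F ≅ cohomology F n :=
  (injectiveResolution F).isoRightDerivedObj _ n ≪≫
    NatIso.ofComponents (fun W =>
      (homologyMapComplexIso (presheafEval A W)
        (((TopCat.Sheaf.forget (ModuleCat.{u} A) X).mapHomologicalComplex
          (ComplexShape.up ℕ)).obj (injectiveResolution F).cocomplex) n).symm ≪≫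
      ((injectiveResolution F).isoRightDerivedObj (sections A W) n).symm)
      (by
        intro V W i
        let I := injectiveResolution F
        let K := ((TopCat.Sheaf.forget (ModuleCat.{u} A) X).mapHomologicalComplex
          (ComplexShape.up ℕ)).obj I.cocomplex
        let H (U : (Opens X)ᵒᵖ) :=
          (((presheafEval A U).mapHomologicalComplex (ComplexShape.up ℕ)).obj K).homology n
        let e (U : (Opens X)ᵒᵖ) : H U ≅ (K.homology n).obj U :=
          homologyMapComplexIso (presheafEval A U) K n
        let q (U : (Opens X)ᵒᵖ) : ((sections A U).rightDerived n).obj F ≅ H U :=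
          I.isoRightDerivedObj (sections A U) n
        let a : H V ⟶ H W := HomologicalComplex.homologyMap ((NatTrans.mapHomologicalComplex
          (sectionsRes A i) (ComplexShape.up ℕ)).app I.cocomplex) n
        -- Evaluation at an open set is exact, so homology of the complex of presheaves is computed
        -- on sections, compatibly with restriction.
        have h₁ : a = (e V).hom ≫ (K.homology n).map i ≫ (e W).inv :=
          (K.sc n).homologyMap_mapNatTrans (F := presheafEval A V) (G := presheafEval A W)
            ((evaluation (Opens X)ᵒᵖ (ModuleCat.{u} A)).map i)
        have h₂ : (NatTrans.rightDerived (sectionsRes A i) n).app F =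
          (q V).hom ≫ a ≫ (q W).inv := I.rightDerived_app_eq (sectionsRes A i) n
        change (K.homology n).map i ≫ (e W).inv ≫ (q W).inv =
          ((e V).inv ≫ (q V).inv) ≫ (NatTrans.rightDerived (sectionsRes A i) n).app F
        rw [h₂, h₁]
        simp only [Category.assoc, Iso.inv_hom_id_assoc])

/-- The stalk at a point of `Y` of the direct image of presheaves. -/
abbrev directStalk (A : Type u) [CommRing A] (f : X ⟶ Y) (y : Y) :
    TopCat.Presheaf (ModuleCat.{u} A) X ⥤ ModuleCat.{u} A :=
  TopCat.Presheaf.pushforward (ModuleCat.{u} A) f ⋙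
    TopCat.Presheaf.stalkFunctor (ModuleCat.{u} A) y

/-- The inclusion of the sections supported in `Z`. -/
def supportInclusion (A : Type u) [CommRing A] (Z : Closeds Y) :
    sectionsWithSupport A Z ⋙ TopCat.Sheaf.forget (ModuleCat.{u} A) Y ⟶
      TopCat.Sheaf.forget (ModuleCat.{u} A) Y where
  app _ := { app := fun _ => ModuleCat.ofHom (Submodule.subtype _)
             naturality := fun _ _ _ => rfl }
  naturality _ _ _ := rfl

variable {f : X ⟶ Y} (hf : IsOpenEmbedding f)

/-- The restriction of a presheaf to an open subset. -/
def restrictionUnit : 𝟭 (TopCat.Presheaf (ModuleCat.{u} A) Y) ⟶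
    (Functor.whiskeringLeft _ _ _).obj hf.functor.op ⋙
      TopCat.Presheaf.pushforward (ModuleCat.{u} A) f where
  app P :=
    { app := fun U => P.map (hf.isOpenMap.adjunction.counit.app U.unop).op
      naturality := fun U V i => by
        change P.map _ ≫ P.map _ = P.map _ ≫ P.map _
        rw [← P.map_comp, ← P.map_comp]
        rfl }
  naturality P Q φ := by
    refine NatTrans.ext (funext fun U => ?_)
    exact (φ.naturality _).symm

variable {Z : Closeds Y}

theorem mem_supportedFamily_iff (hZ : Set.range f = (Z : Set Y)ᶜ)
    (F : TopCat.Sheaf (ModuleCat.{u} A) Y) (U : Opens Y) (s : F.presheaf.obj (op U)) :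
    s ∈ (supportedFamily Z F).carrier U ↔
      F.presheaf.map (hf.isOpenMap.adjunction.counit.app U).op s = 0 := by
  refine map_eq_zero_iff_of_eq F.presheaf ?_ _ _ s
  ext y
  constructor
  · rintro ⟨hy, hyZ⟩
    obtain ⟨x, rfl⟩ := hZ.superset hyZ
    exact ⟨x, hy, rfl⟩
  · rintro ⟨x, hx, rfl⟩
    exact ⟨hx, hZ.subset ⟨x, rfl⟩⟩

theorem supportInclusion_restrictionUnit (hZ : Set.range f = (Z : Set Y)ᶜ)
    (F : TopCat.Sheaf (ModuleCat.{u} A) Y) :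
    (supportInclusion A Z).app F ≫ (restrictionUnit hf).app F.presheaf = 0 := by
  ext U s
  exact (mem_supportedFamily_iff hf hZ F U _).1 s.2

/-- Surjectivity on the right is flasqueness of `J`, so the sequence is exact over each open set and
no sheafification intervenes. -/
theorem support_shortExact (hZ : Set.range f = (Z : Set Y)ᶜ)
    {J : TopCat.Sheaf (ModuleCat.{u} A) Y} (hJ : Injective J) :
    (ShortComplex.mk ((supportInclusion A Z).app J) ((restrictionUnit hf).app J.presheaf)
      (supportInclusion_restrictionUnit hf hZ J)).ShortExact := by
  refine shortExact_of_evaluation _ (fun U => ?_)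
  exact
    { exact := (ShortComplex.moduleCat_exact_iff _).2 fun s hs =>
        ⟨⟨s, (mem_supportedFamily_iff hf hZ J U.unop s).2 hs⟩, rfl⟩
      mono_f := (ModuleCat.mono_iff_injective _).2 Subtype.val_injective
      epi_g := (ModuleCat.epi_iff_surjective _).2 (map_surjective_of_injective hJ _) }

end Comparison

/-! ### Stalks of sections with support in terms of reduced cohomology. -/

section ReducedCohomology

variable {A : Type u} [CommRing A] {X Y : TopCat.{u}} {f : X ⟶ Y} (hf : IsOpenEmbedding f)
  {Z : Closeds Y} (y : Y)

/-- The stalk at `y` of the inclusion of the sections supported in `Z`. -/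
def stalkSupportInclusion (A : Type u) [CommRing A] (Z : Closeds Y) (y : Y) :
    stalkWithSupport A Z y ⟶ TopCat.Sheaf.forget (ModuleCat.{u} A) Y ⋙
      TopCat.Presheaf.stalkFunctor (ModuleCat.{u} A) y :=
  Functor.whiskerRight (supportInclusion A Z) (TopCat.Presheaf.stalkFunctor (ModuleCat.{u} A) y)

/-- The stalk at `y` of the restriction to an open subset. -/
def stalkRestriction (A : Type u) [CommRing A] {f : X ⟶ Y} (hf : IsOpenEmbedding f) (y : Y) :
    TopCat.Sheaf.forget (ModuleCat.{u} A) Y ⋙ TopCat.Presheaf.stalkFunctor (ModuleCat.{u} A) y ⟶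
      openRestrict A hf ⋙ TopCat.Sheaf.forget (ModuleCat.{u} A) X ⋙ directStalk A f y :=
  Functor.whiskerLeft (TopCat.Sheaf.forget (ModuleCat.{u} A) Y)
    (Functor.whiskerRight (restrictionUnit hf)
      (TopCat.Presheaf.stalkFunctor (ModuleCat.{u} A) y))

theorem stalkSupportInclusion_stalkRestriction (hZ : Set.range f = (Z : Set Y)ᶜ) :
    stalkSupportInclusion A Z y ≫ stalkRestriction A hf y = 0 := by
  ext F : 2
  refine ((TopCat.Presheaf.stalkFunctor (ModuleCat.{u} A) y).map_comp _ _).symm.trans ?_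
  exact (congrArg _ (supportInclusion_restrictionUnit hf hZ F)).trans (Functor.map_zero _ _ _)

theorem stalk_support_shortExact (hZ : Set.range f = (Z : Set Y)ᶜ)
    (J : TopCat.Sheaf (ModuleCat.{u} A) Y) [Injective J] :
    (ShortComplex.mk ((stalkSupportInclusion A Z y).app J) ((stalkRestriction A hf y).app J)
      (congrArg (fun t => t.app J)
        (stalkSupportInclusion_stalkRestriction hf y hZ))).ShortExact :=
  (support_shortExact hf hZ ‹Injective J›).map_of_exact
    (TopCat.Presheaf.stalkFunctor (ModuleCat.{u} A) y)

/-- The stalk of the direct image of the cohomology presheaf of the constant sheaf. -/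
def directStalkCohomologyIso (n : ℕ) :
    ((openRestrict A hf ⋙ TopCat.Sheaf.forget (ModuleCat.{u} A) X ⋙
        directStalk A f y).rightDerived n).obj (constSheaf A Y) ≅
      (directStalk A f y).obj (cohomology (constSheaf A X) n) :=
  rightDerivedPrecompIso (openRestrict A hf)
      (TopCat.Sheaf.forget (ModuleCat.{u} A) X ⋙ directStalk A f y) n (constSheaf A Y) ≪≫
    ((TopCat.Sheaf.forget (ModuleCat.{u} A) X ⋙ directStalk A f y).rightDerived n).mapIso
      (openRestrictConstSheafIso A hf).symm ≪≫
    rightDerivedCompIso (TopCat.Sheaf.forget (ModuleCat.{u} A) X) (directStalk A f y) n _ ≪≫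
    (directStalk A f y).mapIso (cohomologyIso (constSheaf A X) n)

/-- The stalk of the constant sheaf. -/
def stalkConstIso :
    (directStalk A f y).obj ((Functor.const (Opens X)ᵒᵖ).obj (ModuleCat.of A A)) ≅
      (TopCat.Sheaf.forget (ModuleCat.{u} A) Y ⋙
        TopCat.Presheaf.stalkFunctor (ModuleCat.{u} A) y).obj (constSheaf A Y) :=
  -- The direct image of the constant presheaf on `X` is by definition the constant presheaf on `Y`,
  -- with value `A` even on open sets whose preimage is empty.
  @asIso _ _ _ _ ((TopCat.Presheaf.stalkFunctor (ModuleCat.{u} A) y).map (constSection A Y))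
    (stalk_constSection_isIso y)

/-- The stalk of the direct image of the zeroth cohomology of the constant sheaf. -/
def directStalkCohomologyZeroIso :
    (directStalk A f y).obj (cohomology (constSheaf A X) 0) ≅
      (openRestrict A hf ⋙ TopCat.Sheaf.forget (ModuleCat.{u} A) X ⋙
        directStalk A f y).obj (constSheaf A Y) :=
  (directStalk A f y).mapIso ((asIso (toCohomologyZero (constSheaf A X))).symm ≪≫
    (TopCat.Sheaf.forget (ModuleCat.{u} A) X).mapIso (openRestrictConstSheafIso A hf))

/-- Both ways round the square send `a` to the germ of the constant section `a` on the open subset.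
-/
theorem augmentation_stalk :
    (directStalk A f y).map (augmentation A X) ≫ (directStalkCohomologyZeroIso hf y).hom =
      (stalkConstIso y).hom ≫ (stalkRestriction A hf y).app (constSheaf A Y) := by
  have h : augmentation A X ≫ (asIso (toCohomologyZero (constSheaf A X))).inv ≫
      (openRestrictConstSheafIso A hf).hom.1 =
        Functor.whiskerLeft hf.functor.op (constSection A Y) := by
    rw [← constSection_openRestrictConstSheafIso hf, augmentation, Category.assoc]
    refine congrArg (constSection A X ≫ ·) ?_
    exact (asIso (toCohomologyZero (constSheaf A X))).hom_inv_id_assoc _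
  refine ((directStalk A f y).map_comp _ _).symm.trans ?_
  refine (congrArg (directStalk A f y).map h).trans ?_
  refine Eq.trans ?_ ((TopCat.Presheaf.stalkFunctor (ModuleCat.{u} A) y).map_comp
    (constSection A Y) ((restrictionUnit hf).app (constSheaf A Y).presheaf))
  refine congrArg (TopCat.Presheaf.stalkFunctor (ModuleCat.{u} A) y).map ?_
  refine NatTrans.ext (funext fun U => ?_)
  exact (Category.id_comp _).symm.trans ((constSection A Y).naturality
    (hf.isOpenMap.adjunction.counit.app U.unop).op)

/-- Right derived functors of sections with support in the complement of an open subset, in terms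
of the reduced cohomology presheaf of this open subset. -/
theorem stalkWithSupport_rightDerived_iso (hf : IsOpenEmbedding f) (y : Y)
    (hZ : Set.range f = (Z : Set Y)ᶜ) (n : ℕ) :
    Nonempty (((stalkWithSupport A Z y).rightDerived n).obj (constSheaf A Y) ≅
      (directStalk A f y).obj (reducedCohomology A X (Int.ofNat n - 1))) := by
  have w := stalkSupportInclusion_stalkRestriction (A := A) hf y hZ
  have hex := stalk_support_shortExact (A := A) hf y hZ
  -- Degrees `0` and `1` land in `H̃^{-1}` and `H̃^0`, the kernel and cokernel of the augmentation,
  -- which the exact functor `directStalk` preserves.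
  match n with
  | 0 =>
    obtain ⟨e⟩ := rightDerived_zero_iso _ _ w (fun J _ => hex J) (constSheaf A Y)
    exact ⟨e ≪≫ (kernel.mapIso _ _ _ _ (augmentation_stalk hf y)).symm ≪≫
      (PreservesKernel.iso (directStalk A f y) (augmentation A X)).symm⟩
  | 1 =>
    obtain ⟨e⟩ := rightDerived_one_iso _ _ w (fun J _ => hex J) (constSheaf A Y)
    exact ⟨e ≪≫ (cokernel.mapIso _ _ _ _ (augmentation_stalk hf y)).symm ≪≫
      (PreservesCokernel.iso (directStalk A f y) (augmentation A X)).symm⟩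
  | n + 2 =>
    obtain ⟨e⟩ := rightDerived_succ_succ_iso _ _ w (fun J _ => hex J) (constSheaf A Y) n
    have h : Int.ofNat (n + 2) - 1 = Int.ofNat (n + 1) := by
      simp only [Int.ofNat_eq_natCast]
      push_cast
      ring
    rw [h]
    exact ⟨e ≪≫ directStalkCohomologyIso hf y (n + 1)⟩

end ReducedCohomology

/-! ### Local Morse data of constant sheaves, and the theorem. -/

theorem lmd_constSheaf {A : Type u} [CommRing A] {X : Type u} [TopologicalSpace X] (f : C(X, ℝ))
    (x : X) (i : ℤ) :
    Nonempty (LMD (constSheaf A (TopCat.of X)) f x i ≅ limReducedCohomology A f x (i - 1)) := by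
  have hj : IsOpenEmbedding (incl {y : X | f y < f x}) :=
    (isOpen_lt f.continuous continuous_const).isOpenEmbedding_subtypeVal
  have hZ : Set.range (incl {y : X | f y < f x}) =
      (superlevel f x : Set (TopCat.of X))ᶜ := by
    refine Subtype.range_coe.trans ?_
    ext y
    exact (not_le (a := f x) (b := f y)).symm
  obtain n | n := i
  · obtain ⟨e⟩ := stalkWithSupport_rightDerived_iso (A := A) hj x hZ n
    -- The stalk at `x` of the direct image presheaf is by definition the colimit in
    -- `limReducedCohomology`.
    exact ⟨lmdIso _ f x n ≪≫ e⟩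
  -- For `i < 0` the degree `i - 1` is at most `-2`, so both sides vanish.
  · have h : Int.negSucc n - 1 = Int.negSucc (n + 1) := by
      simp only [Int.negSucc_eq]
      push_cast
      ring
    rw [h]
    have hz : IsZero ((directStalk A (incl {y : X | f y < f x}) x).obj
        (reducedCohomology A (TopCat.of {y : X | f y < f x}) (Int.negSucc (n + 1)))) := by
      refine Functor.map_isZero _ ((Functor.isZero_iff _).2 fun U => ?_)
      exact ModuleCat.isZero_of_subsingleton (ModuleCat.of A PUnit)
    exact ⟨(ModuleCat.isZero_of_subsingleton (ModuleCat.of A PUnit)).iso hz⟩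

end LocalMorse

end

theorem mainTheorem10 {A : Type u} [CommRing A] [IsDomain A] [IsPrincipalIdealRing A]
    {X : Type u} [TopologicalSpace X] [T2Space X] [LocallyCompactSpace X]
    (f : C(X, ℝ)) (S : Set X) (hS : IsClosed S) (V : Opens S) (x : S) (hx : x ∈ V) (i : ℤ) :
    Nonempty
        (LocalMorse.LMD (LocalMorse.cutOff (LocalMorse.constSheaf A (TopCat.of X)) S) f x.1 i ≅
          LocalMorse.LMD (LocalMorse.constSheaf A (TopCat.of S)) (f.restrict S) x i) ∧
      Nonempty
        (LocalMorse.LMD (LocalMorse.constSheaf A (TopCat.of S)) (f.restrict S) x i ≅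
          LocalMorse.LMD (LocalMorse.constSheaf A (TopCat.of V)) ((f.restrict S).restrict V)
            ⟨x, hx⟩ i) ∧
      Nonempty
        (LocalMorse.LMD (LocalMorse.constSheaf A (TopCat.of V)) ((f.restrict S).restrict V)
            ⟨x, hx⟩ i ≅
          LocalMorse.limReducedCohomology A (f.restrict S) x (i - 1)) := by
  obtain ⟨e₁⟩ := LocalMorse.lmd_congr (LocalMorse.cutOffConstSheafIso A hS) f x.1 i
  obtain ⟨e₂⟩ := LocalMorse.lmd_pushforward (A := A) ⟨Subtype.val, continuous_subtype_val⟩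
    hS.isClosedEmbedding_subtypeVal f x (LocalMorse.constSheaf A (TopCat.of S)) i
  obtain ⟨e₃⟩ := LocalMorse.lmd_openRestrict (A := A)
    (⟨Subtype.val, continuous_subtype_val⟩ : C(V, S)) V.2.isOpenEmbedding_subtypeVal
    (f.restrict S) ⟨x, hx⟩ (LocalMorse.constSheaf A (TopCat.of S)) i
  obtain ⟨e₄⟩ := LocalMorse.lmd_congr (LocalMorse.openRestrictConstSheafIso A
    (f := TopCat.ofHom (⟨Subtype.val, continuous_subtype_val⟩ : C(V, S)))
    V.2.isOpenEmbedding_subtypeVal).symm ((f.restrict S).restrict V) ⟨x, hx⟩ i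
  obtain ⟨e₅⟩ := LocalMorse.lmd_constSheaf (A := A) (f.restrict S) x i
  exact ⟨⟨e₁ ≪≫ e₂⟩, ⟨e₃ ≪≫ e₄⟩, ⟨(e₃ ≪≫ e₄).symm ≪≫ e₅⟩⟩
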